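/- Let $\Omega$ be a non-empty set, $\mathcal{E}\subseteq\wp(\Omega)$ a non-empty family of events, and $Bel:\mathcal{E}\to[0,1]$ an arbitrary function (a belief assessment). For a non-empty $\mathcal{G}\subseteq\mathcal{E}$ let $\mathcal{A}_{\mathcal{G}}$ be the smallest algebra of subsets of $\Omega$ containing $\mathcal{G}$, let $\mathcal{U}_{\mathcal{G}}=\mathcal{A}_{\mathcal{G}}\setminus\{\emptyset\}$, for $A\in\mathcal{A}_{\mathcal{G}}$ let $\tilde A=\{B\in\mathcal{U}_{\mathcal{G}}: B\subseteq A\}$, and let $\tilde{\mathcal{A}}_{\mathcal{G}}$ be the algebra of subsets of $\mathcal{U}_{\mathcal{G}}$ generated by $\{\tilde A: A\in\mathcal{U}_{\mathcal{G}}\}$. For events $E$ and $B\neq\emptyset$, let $u_B(E)=\min_{\omega\in B}\mathbf{1}_E(\omega)$, i.e. $u_B(E)=1$ if $B\subseteq E$ and $u_B(E)=0$ otherwise. A belief function on an algebra $\mathcal{A}$ of subsets of $\Omega$ is a map $b:\mathcal{A}\to[0,1]$ with $b(\emptyset)=0$, $b(\Omega)=1$ and, for all $k\ge 2$ and $A_1,\dots,A_k\in\mathcal{A}$,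 $$b\Big(\bigcup_{i=1}^k A_i\Big)\ \ge \sum_{\emptyset\ne I\subseteq\{1,\dots,k\}}(-1)^{|I|+1}\,b\Big(\bigcap_{i\in I}A_i\Big).$$ Then the following five statements are equivalent. 1. There is a belief function $Bel'$ on $\mathcal{A}_{\mathcal{E}}$ with $Bel'(E)=Bel(E)$ for every $E\in\mathcal{E}$. 2. There is a finitely additive probability $\mu:\tilde{\mathcal{A}}_{\mathcal{E}}\to[0,1]$ such that $Bel(E)=\int_{\mathcal{U}_{\mathcal{E}}}u_B(E)\,\mu(\mathrm{d}B)$ for every $E\in\mathcal{E}$, where the integral is the Stieltjes integral of a bounded function (the common value of the supremum of the lower sums and the infimum of the upper sums over finite partitions of $\mathcal{U}_{\mathcal{E}}$ into members of $\tilde{\mathcal{A}}_{\mathcal{E}}$). 3. For every non-empty finite $\mathcal{F}\subseteq\mathcal{E}$ there are numbers $x_B\ge 0$ ($B\in\mathcal{U}_{\mathcal{F}}$) with $\sum_{B\in\mathcal{U}_{\mathcal{F}}}x_B=1$ and $\sum_{B\in\mathcal{U}_{\mathcal{F}}}u_B(E)\,x_B=Bel(E)$ for every $E\in\mathcal{F}$.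 4. For every non-empty finite $\mathcal{F}\subseteq\mathcal{E}$ and all real stakes $(\lambda_E)_{E\in\mathcal{F}}$, $\max_{B\in\mathcal{U}_{\mathcal{F}}}\sum_{E\in\mathcal{F}}\lambda_E\,(u_B(E)-Bel(E))\ge 0$. 5. For every non-empty finite $\mathcal{F}\subseteq\mathcal{E}$ there is no function $Bel^*:\mathcal{F}\to[0,1]$, different from the restriction of $Bel$ to $\mathcal{F}$, such that $\sum_{E\in\mathcal{F}}(u_B(E)-Bel^*(E))^2<\sum_{E\in\mathcal{F}}(u_B(E)-Bel(E))^2$ for every $B\in\mathcal{U}_{\mathcal{F}}$. -/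

import Mathlib

open Set MeasureTheory

noncomputable section

namespace BeliefCoherence

/-! ### Events and the pessimistic indicator -/

/-- The algebra of sets generated by a finite family is finite. -/
theorem finite_generateSetAlgebra {Ω : Type*} {G : Set (Set Ω)} (hG : G.Finite) :
    (generateSetAlgebra G).Finite := by
  have hB : (G ∪ compl '' G).Finite := hG.union (hG.image _)
  refine ((hB.finite_subsets.finite_subsets).image
    (fun A : Set (Set (Set Ω)) => ⋃ a ∈ A, ⋂ t ∈ a, t)).subset ?_
  intro s hs
  obtain ⟨A, -, -, hA, rfl⟩ := mem_generateSetAlgebra_elim hs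
  refine ⟨A, fun a ha t ht => ?_, rfl⟩
  rcases hA a ha t ht with h | h
  · exact Or.inl h
  · exact Or.inr ⟨tᶜ, h, compl_compl t⟩

/-- The set `𝒰_𝒢` of the non-empty events of the algebra generated by the family `𝒢`. -/
def NonemptyEvents {Ω : Type*} (𝒢 : Set (Set Ω)) : Type _ :=
  {B : Set Ω // B ∈ generateSetAlgebra 𝒢 ∧ B.Nonempty}

/-- `min_{ω ∈ B} 1_E(ω)`, where `1_E` is the indicator of `E`. -/
def minInd {Ω : Type*} (E B : Set Ω) : ℝ :=
  sInf (E.indicator (fun _ => (1 : ℝ)) '' B)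

open Classical in
theorem minInd_eq_ite {Ω : Type*} (E : Set Ω) {B : Set Ω} (hB : B.Nonempty) :
    minInd E B = if B ⊆ E then 1 else 0 := by
  unfold minInd
  split_ifs with h
  · have : E.indicator (fun _ => (1 : ℝ)) '' B = {1} := by
      ext y
      constructor
      · rintro ⟨ω, hω, rfl⟩
        simp [indicator_of_mem (h hω)]
      · rintro rfl
        obtain ⟨ω, hω⟩ := hB
        exact ⟨ω, hω, indicator_of_mem (h hω) _⟩
    rw [this, csInf_singleton]
  · obtain ⟨ω, hω, hE⟩ := not_subset.mp h
    refine IsLeast.csInf_eq ⟨⟨ω, hω, indicator_of_notMem hE _⟩, ?_⟩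
    rintro _ ⟨η, -, rfl⟩
    exact indicator_nonneg (fun _ _ => zero_le_one) η

/-- On a non-empty event, `minInd` is an attained minimum. -/
theorem isLeast_minInd {Ω : Type*} (E : Set Ω) {B : Set Ω} (hB : B.Nonempty) :
    IsLeast (E.indicator (fun _ => (1 : ℝ)) '' B) (minInd E B) := by
  classical
  have hfin : (E.indicator (fun _ => (1 : ℝ)) '' B).Finite := by
    refine (toFinite ({0, 1} : Set ℝ)).subset ?_
    rintro _ ⟨ω, -, rfl⟩
    by_cases h : ω ∈ E <;> simp [h]
  exact ⟨(hB.image _).csInf_mem hfin, fun y hy => csInf_le hfin.bddBelow hy⟩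

/-! ### Belief functions -/

/-- `b` is a belief function on the algebra `𝒜`: it takes values in `[0,1]` on `𝒜`, it is
normalized, and it is completely monotone on `𝒜`. Its values outside `𝒜` play no role. -/
structure IsBeliefFunction {Ω : Type*} (𝒜 : Set (Set Ω)) (b : Set Ω → ℝ) : Prop where
  mem_Icc : ∀ A ∈ 𝒜, b A ∈ Icc (0 : ℝ) 1
  empty : b ∅ = 0
  univ : b Set.univ = 1
  completelyMonotone : ∀ k : ℕ, 2 ≤ k → ∀ A : Fin k → Set Ω, (∀ i, A i ∈ 𝒜) →
    ∑ I : Finset (Fin k) with I.Nonempty, (-1 : ℝ) ^ (I.card + 1) * b (⋂ i ∈ I, A i)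
      ≤ b (⋃ i, A i)

/-! ### Finitely additive probabilities and the Stieltjes integral -/

/-- The finitely additive set function `μ` on `C` is a finitely additive probability. -/
structure IsFinAddProb {α : Type*} {C : Set (Set α)} (μ : AddContent ℝ C) : Prop where
  mem_Icc : ∀ s ∈ C, μ s ∈ Icc (0 : ℝ) 1
  univ : μ Set.univ = 1

/-- `P` is a finite partition of the whole space into members of `C`. -/
structure IsFinPartition {α : Type*} (C : Set (Set α)) (P : Finset (Set α)) : Prop where
  mem : ∀ s ∈ P, s ∈ C
  disjoint : (P : Set (Set α)).PairwiseDisjoint id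
  cover : ⋃₀ (P : Set (Set α)) = Set.univ

/-- Lower sum of `f` over `P`. -/
def lowerSum {α : Type*} {C : Set (Set α)} (μ : AddContent ℝ C) (f : α → ℝ)
    (P : Finset (Set α)) : ℝ :=
  ∑ s ∈ P, sInf (f '' s) * μ s

/-- Upper sum of `f` over `P`. -/
def upperSum {α : Type*} {C : Set (Set α)} (μ : AddContent ℝ C) (f : α → ℝ)
    (P : Finset (Set α)) : ℝ :=
  ∑ s ∈ P, sSup (f '' s) * μ s

/-- The bounded function `f` is Stieltjes integrable with respect to the non-negative finitely
additive `μ` on the algebra `C`, with integral `I`: the supremum of the lower sums and the infimum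
of the upper sums, over all finite partitions of the space into members of `C`, both equal `I`. -/
structure HasStieltjesIntegral {α : Type*} {C : Set (Set α)} (μ : AddContent ℝ C) (f : α → ℝ)
    (I : ℝ) : Prop where
  bddBelow : BddBelow (range f)
  bddAbove : BddAbove (range f)
  isLUB_lower : IsLUB {r | ∃ P, IsFinPartition C P ∧ r = lowerSum μ f P} I
  isGLB_upper : IsGLB {r | ∃ P, IsFinPartition C P ∧ r = upperSum μ f P} I

/-- `Ã = {B ∈ 𝒰_𝒢 : B ⊆ A}`. -/
def tilde {Ω : Type*} (𝒢 : Set (Set Ω)) (A : Set Ω) : Set (NonemptyEvents 𝒢) :=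
  {B | B.1 ⊆ A}

/-- The algebra of subsets of `𝒰_𝒢` generated by the sets `Ã`, `A ∈ 𝒰_𝒢`. -/
def tildeAlgebra {Ω : Type*} (𝒢 : Set (Set Ω)) : Set (Set (NonemptyEvents 𝒢)) :=
  generateSetAlgebra (range fun A : NonemptyEvents 𝒢 => tilde 𝒢 A.1)

/-! ### Coherence of a belief assessment `Bel : 𝓔 → [0,1]` -/

/-- The set `𝒰_𝓕` for a finite subfamily `𝓕` of `𝓔`. -/
abbrev FinEvents {Ω : Type*} {𝓔 : Set (Set Ω)} (𝓕 : Finset 𝓔) : Type _ :=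
  NonemptyEvents (Subtype.val '' (𝓕 : Set 𝓔))

instance {Ω : Type*} {𝓔 : Set (Set Ω)} (𝓕 : Finset 𝓔) : Fintype (FinEvents 𝓕) :=
  ((finite_generateSetAlgebra (𝓕.finite_toSet.image Subtype.val)).subset
    (fun _ hB => hB.1 :
      {B | B ∈ generateSetAlgebra (Subtype.val '' (𝓕 : Set 𝓔)) ∧ B.Nonempty} ⊆ _)).fintype

/-- Extendibility to a belief function on the generated algebra. -/
def Coherent1 {Ω : Type*} {𝓔 : Set (Set Ω)} (Bel : 𝓔 → Icc (0 : ℝ) 1) : Prop :=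
  ∃ Bel' : Set Ω → ℝ, IsBeliefFunction (generateSetAlgebra 𝓔) Bel' ∧
    ∀ E : 𝓔, (Bel E : ℝ) = Bel' E

/-- Integral representation by a finitely additive probability on the algebra generated by the
sets `Ã`. -/
def Coherent2 {Ω : Type*} {𝓔 : Set (Set Ω)} (Bel : 𝓔 → Icc (0 : ℝ) 1) : Prop :=
  ∃ μ : AddContent ℝ (tildeAlgebra 𝓔), IsFinAddProb μ ∧
    ∀ E : 𝓔, HasStieltjesIntegral μ (fun B : NonemptyEvents 𝓔 => minInd E B.1) (Bel E)

/-- Compatibility of the linear system of every finite subfamily. -/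
def Coherent3 {Ω : Type*} {𝓔 : Set (Set Ω)} (Bel : 𝓔 → Icc (0 : ℝ) 1) : Prop :=
  ∀ 𝓕 : Finset 𝓔, 𝓕.Nonempty →
    ∃ x : FinEvents 𝓕 → ℝ,
      (∀ E ∈ 𝓕, ∑ B : FinEvents 𝓕, minInd E B.1 * x B = Bel E) ∧
      ∑ B : FinEvents 𝓕, x B = 1 ∧
      ∀ B : FinEvents 𝓕, 0 ≤ x B

/-- The gain `G_𝓕(B)` of the bets on the members of `𝓕` with stakes `stake`. -/
def gain {Ω : Type*} {𝓔 : Set (Set Ω)} (Bel : 𝓔 → Icc (0 : ℝ) 1) (𝓕 : Finset 𝓔)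
    (stake : 𝓕 → ℝ) (B : FinEvents 𝓕) : ℝ :=
  ∑ E : 𝓕, stake E * (minInd E.1 B.1 - Bel E.1)

/-- No Dutch book under partially resolving uncertainty: the maximum of the gain over `𝒰_𝓕` is
non-negative. -/
def Coherent4 {Ω : Type*} {𝓔 : Set (Set Ω)} (Bel : 𝓔 → Icc (0 : ℝ) 1) : Prop :=
  ∀ 𝓕 : Finset 𝓔, 𝓕.Nonempty → ∀ stake : 𝓕 → ℝ,
    ∃ M : ℝ, IsGreatest (range (gain Bel 𝓕 stake)) M ∧ 0 ≤ M

/-- The global (Brier) penalty at `B` of an assessment `a` on `𝓕`. -/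
def penalty {Ω : Type*} {𝓔 : Set (Set Ω)} (𝓕 : Finset 𝓔) (a : 𝓕 → Icc (0 : ℝ) 1)
    (B : FinEvents 𝓕) : ℝ :=
  ∑ E : 𝓕, (minInd E.1 B.1 - a E) ^ 2

/-- No distinct assessment on a finite subfamily has a uniformly lower penalty. -/
def Coherent5 {Ω : Type*} {𝓔 : Set (Set Ω)} (Bel : 𝓔 → Icc (0 : ℝ) 1) : Prop :=
  ∀ 𝓕 : Finset 𝓔, 𝓕.Nonempty →
    ¬ ∃ Bel' : 𝓕 → Icc (0 : ℝ) 1, Bel' ≠ (fun E => Bel E.1) ∧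
      ∀ B : FinEvents 𝓕, penalty 𝓕 Bel' B < penalty 𝓕 (fun E => Bel E.1) B

end BeliefCoherence

end

open BeliefCoherence

namespace BeliefCoherence

/-! ### Inclusion–exclusion -/

/-! Everything hinges on reading a belief function as a probability on the non-empty events `B`: the
belief in `A` is the mass of those `B` contained in `A`, and `minInd E` is the indicator of `tilde 𝓔
E`. The implications used are 2 → 1 → 3 → 2 and 3 → 4 → 5 → 3.

For 2 → 1, inclusion–exclusion for `μ` on the sets `tilde 𝓔 A` becomes the belief inequality
(`IsFinAddProb.isBeliefFunction_tilde`). For 1 → 3, Möbius inversion on a finite subalgebra gives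
the masses, and complete monotonicity makes them non-negative (`IsBeliefFunction.exists_mobius`).
For 3 → 2, the finite solutions converge along an ultrafilter on the finite subfamilies.

Condition 3 says that `Bel` on `𝓕` lies in the convex hull of the vectors `(u_B(E))_E`. A point of
the hull has expected gain zero, whence 4; expanding squares gives 5; and a point outside the hull
is beaten by its projection (`exists_mem_forall_norm_sub_sq_add_le`). -/

theorem sum_nonempty_neg_one_pow_subset {ι : Type*} [Fintype ι] [DecidableEq ι] (T : Finset ι) :
    ∑ I : Finset ι with I.Nonempty, (-1 : ℝ) ^ (I.card + 1) * (if I ⊆ T then 1 else 0) =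
      if T.Nonempty then 1 else 0 := by
  have h : ∑ I : Finset ι, (-1 : ℝ) ^ (I.card + 1) * (if I ⊆ T then 1 else 0) =
      -(if T = ∅ then 1 else 0) := by
    have hT := congrArg (Int.cast : ℤ → ℝ) (Finset.sum_powerset_neg_one_pow_card (x := T))
    push_cast at hT
    rw [← hT, ← Finset.sum_neg_distrib]
    simp_rw [mul_ite, mul_one, mul_zero]
    rw [← Finset.sum_filter]
    refine Finset.sum_congr (by ext I; simp) fun I _ => by ring
  -- The full alternating sum vanishes unless `T = ∅`; the excluded term `I = ∅` contributes `-1`.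
  rw [← Finset.sum_filter_add_sum_filter_not _ (fun I : Finset ι => I.Nonempty)] at h
  have h0 : (Finset.univ.filter fun I : Finset ι => ¬ I.Nonempty) = {∅} := by
    ext I; simp
  rw [h0, Finset.sum_singleton] at h
  rcases T.eq_empty_or_nonempty with rfl | hT
  · simp
  · simp [hT.ne_empty, hT] at h ⊢
    linarith

/-- Alternating sums of the "upper" sums of a weight collapse to its total over the points lying
in at least one member of the family. -/
theorem sum_nonempty_neg_one_pow_mul_sum {ι β : Type*} [Fintype ι] [DecidableEq ι] [Fintype β]
    (T : β → Finset ι) (w : β → ℝ) :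
    ∑ I : Finset ι with I.Nonempty,
      (-1 : ℝ) ^ (I.card + 1) * ∑ y, (if I ⊆ T y then w y else 0) =
      ∑ y, if (T y).Nonempty then w y else 0 := by
  simp_rw [Finset.mul_sum]
  rw [Finset.sum_comm]
  refine Finset.sum_congr rfl fun y _ => ?_
  have h := congrArg (· * w y) (sum_nonempty_neg_one_pow_subset (T y))
  simp only [Finset.sum_mul, ite_mul, one_mul, zero_mul] at h
  rw [← h]
  refine Finset.sum_congr rfl fun I _ => ?_
  split_ifs <;> simp

open Classical in
/-- Inclusion–exclusion for a finitely additive set function on an algebra of sets. -/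
theorem addContent_iUnion_eq_sum {α ι : Type*} [Fintype ι] {C : Set (Set α)}
    (hC : IsSetAlgebra C) (m : AddContent ℝ C) {A : ι → Set α} (hA : ∀ i, A i ∈ C) :
    m (⋃ i, A i) =
      ∑ I : Finset ι with I.Nonempty, (-1 : ℝ) ^ (I.card + 1) * m (⋂ i ∈ I, A i) := by
  -- The cells are the atoms of the Venn diagram of the `A i`; every intersection, and the union, is
  -- a disjoint union of them.
  let cell : Finset ι → Set α := fun T => {x | ∀ i, x ∈ A i ↔ i ∈ T}
  have hcell : ∀ T, cell T ∈ C := by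
    intro T
    have : cell T = (⋂ i ∈ T, A i) ∩ ⋂ i ∈ Tᶜ, (A i)ᶜ := by
      ext x
      simp only [cell, mem_ofPred_eq, mem_inter_iff, mem_iInter, Finset.mem_compl, mem_compl_iff]
      exact ⟨fun h => ⟨fun i hi => (h i).2 hi, fun i hi hx => hi ((h i).1 hx)⟩,
        fun h i => ⟨fun hx => by_contra fun hi => h.2 i hi hx, h.1 i⟩⟩
    rw [this]
    exact hC.inter_mem (hC.biInter_mem _ fun i _ => hA i)
      (hC.biInter_mem _ fun i _ => hC.compl_mem (hA i))
  have hdis : ∀ T T', T ≠ T' → Disjoint (cell T) (cell T') := by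
    intro T T' hne
    refine Set.disjoint_left.2 fun x hx hx' => hne ?_
    ext i
    exact (hx i).symm.trans (hx' i)
  have hsum : ∀ (p : Finset ι → Prop) [DecidablePred p],
      m (⋃ T ∈ Finset.univ.filter p, cell T) = ∑ T, if p T then m (cell T) else 0 := by
    intro p _
    rw [addContent_biUnion (fun T _ => hcell T) (fun T _ T' _ => hdis T T')
      (hC.biUnion_mem _ fun T _ => hcell T), Finset.sum_filter]
  have hmem : ∀ x, x ∈ cell (Finset.univ.filter fun i => x ∈ A i) := by
    intro x i; simp
  have hinter : ∀ I : Finset ι,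
      (⋂ i ∈ I, A i) = ⋃ T ∈ Finset.univ.filter (fun T => I ⊆ T), cell T := by
    intro I
    ext x
    simp only [mem_iInter, mem_iUnion, Finset.mem_filter_univ, exists_prop]
    exact ⟨fun h => ⟨_, fun i hi => by simpa using h i hi, hmem x⟩,
      fun ⟨T, hT, hx⟩ i hi => (hx i).2 (hT hi)⟩
  have hunion : (⋃ i, A i) = ⋃ T ∈ Finset.univ.filter (fun T : Finset ι => T.Nonempty), cell T := by
    ext x
    simp only [mem_iUnion, Finset.mem_filter_univ, exists_prop]
    exact ⟨fun ⟨i, hi⟩ => ⟨_, ⟨i, by simpa using hi⟩, hmem x⟩,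
      fun ⟨T, ⟨i, hi⟩, hx⟩ => ⟨i, (hx i).2 hi⟩⟩
  simp_rw [hinter, hsum]
  rw [hunion, hsum, sum_nonempty_neg_one_pow_mul_sum (fun T : Finset ι => T)]

/-! ### The Stieltjes integral of an indicator -/

theorem IsFinPartition.sum_inter {α : Type*} {C : Set (Set α)} (hC : IsSetAlgebra C)
    (μ : AddContent ℝ C) {P : Finset (Set α)} (hP : IsFinPartition C P) {S : Set α} (hS : S ∈ C) :
    ∑ s ∈ P, μ (s ∩ S) = μ S := by
  have hU : (⋃ s ∈ P, s ∩ S) = S := by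
    ext x
    simp only [mem_iUnion, mem_inter_iff, exists_prop]
    refine ⟨fun ⟨_, _, _, h⟩ => h, fun h => ?_⟩
    obtain ⟨s, hs, hx⟩ := mem_sUnion.1 (hP.cover.symm ▸ mem_univ x)
    exact ⟨s, hs, hx, h⟩
  rw [← addContent_biUnion (fun s hs => hC.inter_mem (hP.mem s hs) hS), hU]
  · exact fun s hs t ht hne => (hP.disjoint hs ht hne).mono inter_subset_left inter_subset_left
  · rwa [hU]

theorem isFinPartition_compl {α : Type*} [Nonempty α] {C : Set (Set α)} (hC : IsSetAlgebra C)
    [DecidableEq (Set α)] {S : Set α} (hS : S ∈ C) : IsFinPartition C {S, Sᶜ} where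
  mem := by
    simp only [Finset.mem_insert, Finset.mem_singleton, forall_eq_or_imp, forall_eq]
    exact ⟨hS, hC.compl_mem hS⟩
  disjoint := by
    rw [Finset.coe_pair]
    exact pairwise_pair.2 fun _ => ⟨disjoint_compl_right, disjoint_compl_left⟩
  cover := by simp

/-- The integral of the indicator of a member of the algebra is its probability. -/
theorem hasStieltjesIntegral_of_indicator {α : Type*} [Nonempty α] {C : Set (Set α)}
    (hC : IsSetAlgebra C) {μ : AddContent ℝ C} (hμ : IsFinAddProb μ) {S : Set α} (hS : S ∈ C)
    {f : α → ℝ} (h1 : ∀ x ∈ S, f x = 1) (h0 : ∀ x ∉ S, f x = 0) :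
    HasStieltjesIntegral μ f (μ S) := by
  classical
  have hf0 : ∀ x, 0 ≤ f x := fun x => by
    by_cases h : x ∈ S
    · rw [h1 x h]; exact zero_le_one
    · rw [h0 x h]
  have hf1 : ∀ x, f x ≤ 1 := fun x => by
    by_cases h : x ∈ S
    · rw [h1 x h]
    · rw [h0 x h]; exact zero_le_one
  have hbb : ∀ s : Set α, BddBelow (f '' s) := fun s => ⟨0, by rintro _ ⟨x, -, rfl⟩; exact hf0 x⟩
  have hba : ∀ s : Set α, BddAbove (f '' s) := fun s => ⟨1, by rintro _ ⟨x, -, rfl⟩; exact hf1 x⟩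
  have hlow : ∀ s ∈ C, sInf (f '' s) * μ s ≤ μ (s ∩ S) := by
    intro s hs
    by_cases h : s ⊆ S
    · rw [inter_eq_self_of_subset_left h]
      refine mul_le_of_le_one_left (hμ.mem_Icc s hs).1 ?_
      -- An empty block is harmless: the real `sInf ∅` is `0`.
      rcases s.eq_empty_or_nonempty with rfl | ⟨x, hx⟩
      · simp
      · exact (csInf_le (hbb s) ⟨x, hx, rfl⟩).trans (hf1 x)
    · obtain ⟨x, hx, hxS⟩ := not_subset.1 h
      have hle : sInf (f '' s) ≤ 0 := csInf_le (hbb s) ⟨x, hx, h0 x hxS⟩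
      exact (mul_nonpos_of_nonpos_of_nonneg hle (hμ.mem_Icc s hs).1).trans
        (hμ.mem_Icc _ (hC.inter_mem hs hS)).1
  have hup : ∀ s ∈ C, μ (s ∩ S) ≤ sSup (f '' s) * μ s := by
    intro s hs
    have hpos : 0 ≤ sSup (f '' s) := Real.sSup_nonneg (by rintro _ ⟨x, -, rfl⟩; exact hf0 x)
    rcases (s ∩ S).eq_empty_or_nonempty with h | ⟨x, hx, hxS⟩
    · rw [h, addContent_empty]
      exact mul_nonneg hpos (hμ.mem_Icc s hs).1
    · have hle : 1 ≤ sSup (f '' s) := le_csSup (hba s) ⟨x, hx, h1 x hxS⟩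
      have hadd : μ s = μ (s ∩ S) + μ (s \ S) := by
        rw [← addContent_union' (hC.inter_mem hs hS) (hC.sdiff_mem hs hS)
          (by rwa [inter_union_sdiff]) disjoint_sdiff_inter.symm, inter_union_sdiff]
      have h2 := (hμ.mem_Icc _ (hC.sdiff_mem hs hS)).1
      have h3 := (hμ.mem_Icc s hs).1
      nlinarith
  have hlow' : ∀ P, IsFinPartition C P → lowerSum μ f P ≤ μ S := fun P hP =>
    (Finset.sum_le_sum fun s hs => hlow s (hP.mem s hs)).trans_eq (hP.sum_inter hC μ hS)
  have hup' : ∀ P, IsFinPartition C P → μ S ≤ upperSum μ f P := fun P hP =>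
    (hP.sum_inter hC μ hS).symm.trans_le (Finset.sum_le_sum fun s hs => hup s (hP.mem s hs))
  have hne : S ≠ Sᶜ := fun h => by
    obtain ⟨x⟩ := ‹Nonempty α›
    by_cases hx : x ∈ S
    · exact (h ▸ hx : x ∈ Sᶜ) hx
    · exact hx (h ▸ (hx : x ∈ Sᶜ))
  have hS1 : f '' S = if S.Nonempty then {1} else ∅ := by
    split_ifs with h
    · rw [image_congr h1, h.image_const]
    · rw [not_nonempty_iff_eq_empty.1 h, image_empty]
  have hS0 : f '' Sᶜ = if Sᶜ.Nonempty then {0} else ∅ := by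
    split_ifs with h
    · exact (image_congr h0).trans (h.image_const 0)
    · rw [not_nonempty_iff_eq_empty.1 h, image_empty]
  -- On the partition into `S` and its complement both sums equal `μ S`, so the supremum and the
  -- infimum are attained.
  have hP := isFinPartition_compl hC hS
  have hl : lowerSum μ f {S, Sᶜ} = μ S := by
    rw [lowerSum, Finset.sum_pair hne, hS1, hS0]
    split_ifs with h h' h' <;> simp_all
  have hu : upperSum μ f {S, Sᶜ} = μ S := by
    rw [upperSum, Finset.sum_pair hne, hS1, hS0]
    split_ifs with h h' h' <;> simp_all
  exact
    { bddBelow := ⟨0, by rintro _ ⟨x, rfl⟩; exact hf0 x⟩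
      bddAbove := ⟨1, by rintro _ ⟨x, rfl⟩; exact hf1 x⟩
      isLUB_lower := IsGreatest.isLUB
        ⟨⟨_, hP, hl.symm⟩, by rintro _ ⟨P, hP, rfl⟩; exact hlow' P hP⟩
      isGLB_upper := IsLeast.isGLB
        ⟨⟨_, hP, hu.symm⟩, by rintro _ ⟨P, hP, rfl⟩; exact hup' P hP⟩ }

/-! ### Möbius inversion for belief functions -/

-- Solved by well-founded recursion: each `x a` is what remains of `f a` once the values strictly
-- below are subtracted.
open Classical in
theorem exists_sum_le_eq {P : Type*} [PartialOrder P] [Fintype P] (f : P → ℝ) :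
    ∃ x : P → ℝ, ∀ a, x a + ∑ b with b < a, x b = f a := by
  let F : (a : P) → ((b : P) → b < a → ℝ) → ℝ :=
    fun a g => f a - ∑ b : {b // b < a}, g b.1 b.2
  refine ⟨WellFounded.fix (wellFounded_lt (α := P)) F, fun a => ?_⟩
  rw [WellFounded.fix_eq]
  simp only [F]
  rw [Finset.sum_subtype (p := fun b => b < a) (Finset.univ.filter fun b => b < a) (by simp)]
  ring

open Classical in
/-- The restriction of a belief function to a finite subalgebra has a non-negative Möbius
transform. -/
theorem IsBeliefFunction.exists_mobius {Ω : Type*} {𝒜 𝒢 : Set (Set Ω)}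
    [Fintype (NonemptyEvents 𝒢)] {b : Set Ω → ℝ} (hb : IsBeliefFunction 𝒜 b)
    (h𝒢 : generateSetAlgebra 𝒢 ⊆ 𝒜) :
    ∃ x : NonemptyEvents 𝒢 → ℝ, (∀ B, 0 ≤ x B) ∧
      ∀ A ∈ generateSetAlgebra 𝒢, ∑ B : NonemptyEvents 𝒢, (if B.1 ⊆ A then x B else 0) = b A := by
  let _ : PartialOrder (NonemptyEvents 𝒢) :=
    PartialOrder.lift (fun B => B.1) Subtype.val_injective
  have hlt : ∀ B B' : NonemptyEvents 𝒢, B < B' ↔ B.1 ⊂ B'.1 := fun _ _ => Iff.rfl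
  have hG : IsSetAlgebra (generateSetAlgebra 𝒢) := isSetAlgebra_generateSetAlgebra
  obtain ⟨x, hx⟩ := exists_sum_le_eq (fun B : NonemptyEvents 𝒢 => b B.1)
  have hsum : ∀ A ∈ generateSetAlgebra 𝒢,
      ∑ B : NonemptyEvents 𝒢, (if B.1 ⊆ A then x B else 0) = b A := by
    intro A hA
    rcases A.eq_empty_or_nonempty with rfl | hne
    · rw [hb.empty]
      exact Finset.sum_eq_zero fun B _ => if_neg fun h => B.2.2.ne_empty (subset_empty_iff.1 h)
    · let A' : NonemptyEvents 𝒢 := ⟨A, hA, hne⟩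
      have hfil : (Finset.univ.filter fun B : NonemptyEvents 𝒢 => B.1 ⊆ A) =
          insert A' (Finset.univ.filter fun B => B < A') := by
        ext B
        simp only [Finset.mem_filter_univ, Finset.mem_insert]
        exact le_iff_eq_or_lt (a := B) (b := A')
      rw [← Finset.sum_filter, hfil, Finset.sum_insert (by simp)]
      exact hx A'
  refine ⟨x, fun A => ?_, hsum⟩
  -- An atom carries mass `b A ≥ 0`. Any other `A` is the union of its proper non-empty subevents,
  -- to which complete monotonicity applies.
  by_cases hatom : ∃ D : NonemptyEvents 𝒢, D < A
  · obtain ⟨D, hD⟩ := hatom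
    let S := {B : NonemptyEvents 𝒢 // B < A}
    let e : Fin (Fintype.card S) ≃ S := (Fintype.equivFin S).symm
    let s : Fin (Fintype.card S) → Set Ω := fun i => (e i).1.1
    obtain ⟨ω, hω, hωD⟩ := not_subset.1 ((hlt _ _).1 hD).2
    obtain ⟨η, hη⟩ := D.2.2
    -- `D` and its complement in `A` already cover `A`, and being distinct they supply the two sets
    -- that complete monotonicity requires.
    let D' : NonemptyEvents 𝒢 := ⟨A.1 \ D.1, hG.sdiff_mem A.2.1 D.2.1, ω, hω, hωD⟩
    have hD' : D' < A := (hlt _ _).2 ⟨sdiff_subset, fun h => (h (((hlt _ _).1 hD).1 hη)).2 hη⟩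
    have hcard : 2 ≤ Fintype.card S := by
      refine Fintype.one_lt_card_iff.2 ⟨⟨D, hD⟩, ⟨D', hD'⟩, fun h => ?_⟩
      have h' : D = D' := congrArg (fun B : S => B.1) h
      have : η ∈ D'.1 := h' ▸ hη
      exact this.2 hη
    have hmem : ∀ i, s i ∈ generateSetAlgebra 𝒢 := fun i => (e i).1.2.1
    have hunion : (⋃ i, s i) = A.1 := by
      refine subset_antisymm (iUnion_subset fun i => ((hlt _ _).1 (e i).2).1) fun y hy => ?_
      by_cases hyD : y ∈ D.1
      · exact mem_iUnion.2 ⟨e.symm ⟨D, hD⟩, by simpa [s] using hyD⟩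
      · exact mem_iUnion.2 ⟨e.symm ⟨D', hD'⟩, by simp only [s, e.apply_symm_apply]; exact ⟨hy, hyD⟩⟩
    have hcm := hb.completelyMonotone _ hcard s fun i => h𝒢 (hmem i)
    have hcol := sum_nonempty_neg_one_pow_mul_sum
      (fun B : NonemptyEvents 𝒢 => Finset.univ.filter fun i => B.1 ⊆ s i) x
    -- Writing each `b (⋂ i ∈ I, s i)` as a sum of masses, the alternating sum collapses to the
    -- total mass strictly below `A`; what `b A` has beyond it is `x A`.
    have hle : ∑ B with B < A, x B ≤ b A.1 := by
      rw [hunion] at hcm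
      refine le_trans (le_of_eq ?_) hcm
      rw [Finset.sum_filter]
      convert hcol.symm using 1
      · refine Finset.sum_congr rfl fun B _ => if_congr ?_ rfl rfl
        simp only [Finset.Nonempty, Finset.mem_filter_univ]
        refine ⟨fun h => ⟨e.symm ⟨B, h⟩, by simp [s]⟩, fun ⟨i, hi⟩ => ?_⟩
        exact lt_of_le_of_lt (b := (e i).1) hi (e i).2
      · refine Finset.sum_congr (by congr) fun I _ => ?_
        rw [← hsum _ (hG.biInter_mem I fun i _ => hmem i)]
        congr 1
        refine Finset.sum_congr rfl fun B _ => if_congr ?_ rfl rfl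
        simp [Finset.subset_iff]
    linarith [hx A]
  · have hA := hx A
    rw [Finset.sum_eq_zero fun B hB => absurd ⟨B, (Finset.mem_filter.1 hB).2⟩ hatom, add_zero] at hA
    rw [hA]
    exact (hb.mem_Icc _ (h𝒢 A.2.1)).1

/-! ### The sets `Ã` -/

instance {Ω : Type*} [Nonempty Ω] (𝒢 : Set (Set Ω)) : Nonempty (NonemptyEvents 𝒢) :=
  ⟨⟨univ, isSetAlgebra_generateSetAlgebra.univ_mem, univ_nonempty⟩⟩

theorem tilde_empty {Ω : Type*} (𝒢 : Set (Set Ω)) : tilde 𝒢 ∅ = ∅ :=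
  eq_empty_of_forall_notMem fun B h => B.2.2.ne_empty (subset_empty_iff.1 h)

theorem tilde_univ {Ω : Type*} (𝒢 : Set (Set Ω)) : tilde 𝒢 univ = univ :=
  eq_univ_of_forall fun B => subset_univ B.1

theorem tilde_biInter {Ω ι : Type*} (𝒢 : Set (Set Ω)) (I : Finset ι) (A : ι → Set Ω) :
    tilde 𝒢 (⋂ i ∈ I, A i) = ⋂ i ∈ I, tilde 𝒢 (A i) := by
  ext B
  simp [tilde]

theorem tilde_mem_tildeAlgebra {Ω : Type*} {𝒢 : Set (Set Ω)} {A : Set Ω}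
    (hA : A ∈ generateSetAlgebra 𝒢) : tilde 𝒢 A ∈ tildeAlgebra 𝒢 := by
  rcases A.eq_empty_or_nonempty with rfl | hne
  · rw [tilde_empty]
    exact isSetAlgebra_generateSetAlgebra.empty_mem
  · exact self_subset_generateSetAlgebra ⟨⟨A, hA, hne⟩, rfl⟩

theorem isSetAlgebra_tildeAlgebra {Ω : Type*} (𝒢 : Set (Set Ω)) :
    IsSetAlgebra (tildeAlgebra 𝒢) :=
  isSetAlgebra_generateSetAlgebra

theorem hasStieltjesIntegral_minInd {Ω : Type*} [Nonempty Ω] {𝒢 : Set (Set Ω)}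
    {μ : AddContent ℝ (tildeAlgebra 𝒢)} (hμ : IsFinAddProb μ) {E : Set Ω}
    (hE : E ∈ generateSetAlgebra 𝒢) :
    HasStieltjesIntegral μ (fun B : NonemptyEvents 𝒢 => minInd E B.1) (μ (tilde 𝒢 E)) := by
  classical
  refine hasStieltjesIntegral_of_indicator (isSetAlgebra_tildeAlgebra 𝒢) hμ
    (tilde_mem_tildeAlgebra hE) (fun B hB => ?_) fun B hB => ?_
  · exact (minInd_eq_ite E B.2.2).trans (if_pos hB)
  · exact (minInd_eq_ite E B.2.2).trans (if_neg hB)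

theorem IsFinAddProb.mono {α : Type*} {C : Set (Set α)} (hC : IsSetAlgebra C)
    {μ : AddContent ℝ C} (hμ : IsFinAddProb μ) {s t : Set α} (hs : s ∈ C) (ht : t ∈ C)
    (hst : s ⊆ t) : μ s ≤ μ t := by
  have h := addContent_union' (m := μ) hs (hC.sdiff_mem ht hs)
    (by rwa [union_sdiff_cancel hst]) disjoint_sdiff_right
  rw [union_sdiff_cancel hst] at h
  linarith [(hμ.mem_Icc _ (hC.sdiff_mem ht hs)).1]

/-- A finitely additive probability of the sets `Ã` is a belief function. -/
theorem IsFinAddProb.isBeliefFunction_tilde {Ω : Type*} {𝒢 : Set (Set Ω)}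
    {μ : AddContent ℝ (tildeAlgebra 𝒢)} (hμ : IsFinAddProb μ) :
    IsBeliefFunction (generateSetAlgebra 𝒢) fun A => μ (tilde 𝒢 A) where
  mem_Icc A hA := hμ.mem_Icc _ (tilde_mem_tildeAlgebra hA)
  empty := by rw [tilde_empty, addContent_empty]
  univ := by rw [tilde_univ, hμ.univ]
  completelyMonotone k _ A hA := by
    have hC := isSetAlgebra_tildeAlgebra 𝒢
    have hG : IsSetAlgebra (generateSetAlgebra 𝒢) := isSetAlgebra_generateSetAlgebra
    have hmem : ∀ i, tilde 𝒢 (A i) ∈ tildeAlgebra 𝒢 := fun i => tilde_mem_tildeAlgebra (hA i)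
    -- Additivity weakens to an inequality here: an event inside the union need not lie inside any
    -- single `A i`.
    have hle : μ (⋃ i, tilde 𝒢 (A i)) ≤ μ (tilde 𝒢 (⋃ i, A i)) := by
      refine hμ.mono hC ?_ (tilde_mem_tildeAlgebra ?_)
        (iUnion_subset fun i B hB => hB.trans (subset_iUnion A i))
      · simpa using hC.biUnion_mem Finset.univ fun i _ => hmem i
      · simpa using hG.biUnion_mem Finset.univ fun i _ => hA i
    refine le_trans (le_of_eq ?_) hle
    rw [addContent_iUnion_eq_sum hC μ hmem]
    simp_rw [tilde_biInter]

/-! ### The implications -/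

theorem Coherent2.coherent1 {Ω : Type*} [Nonempty Ω] {𝓔 : Set (Set Ω)}
    {Bel : 𝓔 → Icc (0 : ℝ) 1} (h : Coherent2 Bel) : Coherent1 Bel := by
  obtain ⟨μ, hμ, hBel⟩ := h
  exact ⟨_, hμ.isBeliefFunction_tilde, fun E => (hBel E).isLUB_lower.unique
    (hasStieltjesIntegral_minInd hμ (self_subset_generateSetAlgebra E.2)).isLUB_lower⟩

theorem generateSetAlgebra_finset_subset {Ω : Type*} {𝓔 : Set (Set Ω)} (𝓕 : Finset 𝓔) :
    generateSetAlgebra (Subtype.val '' (𝓕 : Set 𝓔)) ⊆ generateSetAlgebra 𝓔 :=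
  generateSetAlgebra_mono (by rintro _ ⟨E, -, rfl⟩; exact E.2)

theorem mem_generateSetAlgebra_finset {Ω : Type*} {𝓔 : Set (Set Ω)} {𝓕 : Finset 𝓔} {E : 𝓔}
    (hE : E ∈ 𝓕) : E.1 ∈ generateSetAlgebra (Subtype.val '' (𝓕 : Set 𝓔)) :=
  self_subset_generateSetAlgebra ⟨E, hE, rfl⟩

theorem Coherent1.coherent3 {Ω : Type*} {𝓔 : Set (Set Ω)}
    {Bel : 𝓔 → Icc (0 : ℝ) 1} (h : Coherent1 Bel) : Coherent3 Bel := by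
  classical
  obtain ⟨b, hb, hBel⟩ := h
  intro 𝓕 _
  obtain ⟨x, hx0, hx⟩ := hb.exists_mobius (generateSetAlgebra_finset_subset 𝓕)
  refine ⟨x, fun E hE => ?_, ?_, hx0⟩
  · rw [hBel E, ← hx _ (mem_generateSetAlgebra_finset hE)]
    refine Finset.sum_congr rfl fun B _ => ?_
    rw [minInd_eq_ite _ B.2.2, ite_mul, one_mul, zero_mul]
  · rw [← hb.univ, ← hx _ isSetAlgebra_generateSetAlgebra.univ_mem]
    simp

/-- Every finite subsystem is realised by a finitely additive probability on all sets of
non-empty events. -/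
theorem Coherent3.exists_finite_approx {Ω : Type*} {𝓔 : Set (Set Ω)} (h𝓔 : 𝓔.Nonempty)
    {Bel : 𝓔 → Icc (0 : ℝ) 1} (h : Coherent3 Bel) (𝓕 : Finset 𝓔) :
    ∃ m : Set (NonemptyEvents 𝓔) → ℝ, (∀ S, m S ∈ Icc (0 : ℝ) 1) ∧ m ∅ = 0 ∧ m univ = 1 ∧
      (∀ S T, Disjoint S T → m (S ∪ T) = m S + m T) ∧ ∀ E ∈ 𝓕, m (tilde 𝓔 E.1) = Bel E := by
  classical
  obtain ⟨E₀, hE₀⟩ := h𝓔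
  -- `𝓕` may be empty, as it ranges over all finite subfamilies in the later limit; inserting `E₀`
  -- makes the hypothesis applicable.
  obtain ⟨x, hx, hx1, hx0⟩ := h (insert ⟨E₀, hE₀⟩ 𝓕) (Finset.insert_nonempty _ _)
  let lift : FinEvents (insert ⟨E₀, hE₀⟩ 𝓕) → NonemptyEvents 𝓔 :=
    fun B => ⟨B.1, generateSetAlgebra_finset_subset _ B.2.1, B.2.2⟩
  have hnn : ∀ (S : Set (NonemptyEvents 𝓔)) B, 0 ≤ if lift B ∈ S then x B else 0 := fun S B => by
    split_ifs
    exacts [hx0 B, le_rfl]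
  refine ⟨fun S => ∑ B, if lift B ∈ S then x B else 0, fun S => ⟨?_, ?_⟩, by simp, by simpa,
    fun S T hST => ?_, fun E hE => ?_⟩
  · exact Finset.sum_nonneg fun B _ => hnn S B
  · rw [← hx1]
    refine Finset.sum_le_sum fun B _ => ?_
    split_ifs
    exacts [le_rfl, hx0 B]
  · simp only
    rw [← Finset.sum_add_distrib]
    refine Finset.sum_congr rfl fun B _ => ?_
    by_cases hS : lift B ∈ S
    · simp [hS, Set.disjoint_left.1 hST hS]
    · simp [hS]
  · rw [← hx E (Finset.mem_insert_of_mem hE)]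
    refine Finset.sum_congr rfl fun B _ => ?_
    rw [minInd_eq_ite _ B.2.2, ite_mul, one_mul, zero_mul]
    rfl

/-- Compactness of `[0,1]`: the approximations are defined on all sets of non-empty events, so they
have a pointwise ultrafilter limit, which inherits additivity and is then restricted to the algebra.
-/
theorem Coherent3.coherent2 {Ω : Type*} [Nonempty Ω] {𝓔 : Set (Set Ω)} (h𝓔 : 𝓔.Nonempty)
    {Bel : 𝓔 → Icc (0 : ℝ) 1} (h : Coherent3 Bel) : Coherent2 Bel := by
  choose m hIcc hempty huniv hadd hBel using h.exists_finite_approx h𝓔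
  let u : Ultrafilter (Finset 𝓔) := Ultrafilter.of Filter.atTop
  have hlim : ∀ S, ∃ r ∈ Icc (0 : ℝ) 1, Filter.Tendsto (fun 𝓕 => m 𝓕 S) u (nhds r) := fun S =>
    (isCompact_Icc (a := (0 : ℝ)) (b := 1)).ultrafilter_le_nhds (u.map fun 𝓕 => m 𝓕 S)
      (Filter.tendsto_principal.2 (Filter.Eventually.of_forall fun 𝓕 => hIcc 𝓕 S))
  choose ν hν01 hν using hlim
  have hν0 : ν ∅ = 0 := tendsto_nhds_unique (hν ∅) (by simpa only [hempty] using tendsto_const_nhds)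
  have hν1 : ν univ = 1 :=
    tendsto_nhds_unique (hν univ) (by simpa only [huniv] using tendsto_const_nhds)
  have hνadd : ∀ S T, Disjoint S T → ν (S ∪ T) = ν S + ν T := fun S T hST =>
    tendsto_nhds_unique (hν (S ∪ T))
      (((hν S).add (hν T)).congr fun 𝓕 => (hadd 𝓕 S T hST).symm)
  have hνBel : ∀ E : 𝓔, ν (tilde 𝓔 E.1) = Bel E := fun E => by
    refine tendsto_nhds_unique (hν _) (tendsto_const_nhds.congr' ?_)
    -- The ultrafilter refines `atTop`, so eventually `𝓕` contains `E` and the value at `tilde 𝓔 E`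
    -- is constant.
    have : ∀ᶠ 𝓕 in (u : Filter (Finset 𝓔)), {E} ⊆ 𝓕 :=
      (Filter.eventually_ge_atTop {E}).filter_mono (Ultrafilter.of_le _)
    filter_upwards [this] with 𝓕 h𝓕
    exact (hBel 𝓕 E (Finset.singleton_subset_iff.1 h𝓕)).symm
  let μ : AddContent ℝ (tildeAlgebra 𝓔) :=
    (isSetAlgebra_tildeAlgebra 𝓔).isSetRing.addContent_of_union ν hν0
      fun {S T} _ _ hST => hνadd S T hST
  have hμν : ∀ S, μ S = ν S := fun _ => rfl
  have hμ : IsFinAddProb μ := ⟨fun S _ => hν01 S, hν1⟩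
  refine ⟨μ, hμ, fun E => ?_⟩
  rw [← hνBel E, ← hμν]
  exact hasStieltjesIntegral_minInd hμ (self_subset_generateSetAlgebra E.2)

theorem Coherent3.coherent4 {Ω : Type*} [Nonempty Ω] {𝓔 : Set (Set Ω)}
    {Bel : 𝓔 → Icc (0 : ℝ) 1} (h : Coherent3 Bel) : Coherent4 Bel := by
  intro 𝓕 h𝓕 stake
  obtain ⟨x, hx, hx1, hx0⟩ := h 𝓕 h𝓕
  obtain ⟨B₀, hB₀⟩ := Finite.exists_max (gain Bel 𝓕 stake)
  refine ⟨gain Bel 𝓕 stake B₀, ⟨mem_range_self _, by rintro _ ⟨B, rfl⟩; exact hB₀ B⟩, ?_⟩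
  -- Under the probability `x` each bet is fair, so the mean gain is zero and the maximal gain
  -- cannot be negative.
  have hzero : ∑ B, gain Bel 𝓕 stake B * x B = 0 := by
    simp only [gain, Finset.sum_mul]
    rw [Finset.sum_comm]
    refine Finset.sum_eq_zero fun E _ => ?_
    simp_rw [mul_assoc, sub_mul]
    rw [← Finset.mul_sum, Finset.sum_sub_distrib, hx E.1 E.2, ← Finset.mul_sum, hx1]
    ring
  calc (0 : ℝ) = ∑ B, gain Bel 𝓕 stake B * x B := hzero.symm
    _ ≤ ∑ B, gain Bel 𝓕 stake B₀ * x B :=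
      Finset.sum_le_sum fun B _ => mul_le_mul_of_nonneg_right (hB₀ B) (hx0 B)
    _ = gain Bel 𝓕 stake B₀ := by rw [← Finset.mul_sum, hx1, mul_one]

theorem Coherent4.coherent5 {Ω : Type*} {𝓔 : Set (Set Ω)}
    {Bel : 𝓔 → Icc (0 : ℝ) 1} (h : Coherent4 Bel) : Coherent5 Bel := by
  rintro 𝓕 h𝓕 ⟨a, -, ha⟩
  -- With stakes `Bel - a`, the difference of penalties is twice the gain plus a sum of squares, so
  -- `a` does no better than `Bel` at the event of maximal gain.
  obtain ⟨_, ⟨⟨B, rfl⟩, -⟩, h0⟩ := h 𝓕 h𝓕 fun E => Bel E.1 - a E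
  have hB := ha B
  have hdiff : penalty 𝓕 a B - penalty 𝓕 (fun E => Bel E.1) B =
      2 * gain Bel 𝓕 (fun E => Bel E.1 - a E) B + ∑ E : 𝓕, ((Bel E.1 : ℝ) - a E) ^ 2 := by
    simp only [penalty, gain, Finset.mul_sum]
    rw [← Finset.sum_sub_distrib, ← Finset.sum_add_distrib]
    exact Finset.sum_congr rfl fun E _ => by ring
  have hsq : 0 ≤ ∑ E : 𝓕, ((Bel E.1 : ℝ) - a E) ^ 2 := Finset.sum_nonneg fun E _ => sq_nonneg _
  linarith

theorem minInd_mem_Icc {Ω : Type*} (E : Set Ω) {B : Set Ω} (hB : B.Nonempty) :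
    minInd E B ∈ Icc (0 : ℝ) 1 := by
  classical
  rw [minInd_eq_ite E hB]
  split_ifs <;> simp

/-- For the projection `p` of `a`, the angle at `p` between `w - p` and `a - p` is not acute, so
expanding `‖(w - p) - (a - p)‖ ^ 2` gives the bound. -/
theorem exists_mem_forall_norm_sub_sq_add_le {F : Type*} [NormedAddCommGroup F]
    [InnerProductSpace ℝ F] {K : Set F} (hne : K.Nonempty) (hK : IsComplete K)
    (hconv : Convex ℝ K) (a : F) :
    ∃ p ∈ K, ∀ w ∈ K, ‖w - p‖ ^ 2 + ‖p - a‖ ^ 2 ≤ ‖w - a‖ ^ 2 := by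
  obtain ⟨p, hp, hmin⟩ := exists_norm_eq_iInf_of_complete_convex hne hK hconv a
  refine ⟨p, hp, fun w hw => ?_⟩
  have h := (norm_eq_iInf_iff_real_inner_le_zero hconv hp).1 hmin w hw
  have h2 := norm_sub_sq_real (w - p) (a - p)
  rw [sub_sub_sub_cancel_right, real_inner_comm, norm_sub_rev a p] at h2
  linarith

theorem Coherent5.coherent3 {Ω : Type*} [Nonempty Ω] {𝓔 : Set (Set Ω)}
    {Bel : 𝓔 → Icc (0 : ℝ) 1} (h : Coherent5 Bel) : Coherent3 Bel := by
  classical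
  intro 𝓕 h𝓕
  let v : FinEvents 𝓕 → EuclideanSpace ℝ 𝓕 := fun B => WithLp.toLp 2 fun E => minInd E.1 B.1
  let a : EuclideanSpace ℝ 𝓕 := WithLp.toLp 2 fun E => (Bel E.1 : ℝ)
  let T : (FinEvents 𝓕 → ℝ) →ₗ[ℝ] EuclideanSpace ℝ 𝓕 := Fintype.linearCombination ℝ v
  have hT : ∀ x (E : 𝓕), T x E = ∑ B, minInd E.1 B.1 * x B := fun x E => by
    simp only [T, Fintype.linearCombination_apply, WithLp.ofLp_sum, Finset.sum_apply,
      WithLp.ofLp_smul, Pi.smul_apply, smul_eq_mul, v]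
    exact Finset.sum_congr rfl fun B _ => mul_comm _ _
  have hv : ∀ B, v B ∈ T '' stdSimplex ℝ (FinEvents 𝓕) := fun B =>
    ⟨Pi.single B 1, single_mem_stdSimplex ℝ B, by simp [T]⟩
  have hcomp : IsCompact (T '' stdSimplex ℝ (FinEvents 𝓕)) :=
    (isCompact_stdSimplex ℝ _).image T.continuous_of_finiteDimensional
  have hconv : Convex ℝ (T '' stdSimplex ℝ (FinEvents 𝓕)) := (convex_stdSimplex ℝ _).linear_image T
  obtain ⟨_, ⟨x, hx, rfl⟩, hmin⟩ := exists_mem_forall_norm_sub_sq_add_le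
    ⟨_, hv (Classical.arbitrary _)⟩ hcomp.isComplete hconv a
  -- If the projection is `a` itself, `x` solves the system; otherwise `T x` is a rival assessment
  -- strictly closer to every vertex `v B`.
  by_cases hTa : T x = a
  · refine ⟨x, fun E hE => ?_, hx.2, hx.1⟩
    rw [← hT x ⟨E, hE⟩, hTa]
  -- The rival is admissible: its coordinates are convex combinations of numbers in `[0,1]`.
  · have hp : ∀ E, T x E ∈ Icc (0 : ℝ) 1 := fun E => by
      rw [hT]
      refine ⟨Finset.sum_nonneg fun B _ => mul_nonneg (minInd_mem_Icc _ B.2.2).1 (hx.1 B), ?_⟩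
      rw [← hx.2]
      exact Finset.sum_le_sum fun B _ =>
        mul_le_of_le_one_left (hx.1 B) (minInd_mem_Icc _ B.2.2).2
    refine absurd ⟨fun E => ⟨T x E, hp E⟩, fun heq => hTa ?_, fun B => ?_⟩ (h 𝓕 h𝓕)
    · ext E
      exact congrArg Subtype.val (congrFun heq E)
    · have hpos : 0 < ‖T x - a‖ ^ 2 := by
        have := norm_pos_iff.2 (sub_ne_zero.2 hTa)
        positivity
      have hlt : ‖v B - T x‖ ^ 2 < ‖v B - a‖ ^ 2 := by linarith [hmin _ (hv B)]
      rw [EuclideanSpace.norm_sq_eq, EuclideanSpace.norm_sq_eq] at hlt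
      simpa [penalty, v, a] using hlt

end BeliefCoherence

open BeliefCoherence
theorem theorem1 {Ω : Type*} [Nonempty Ω] (𝓔 : Set (Set Ω)) (h𝓔 : 𝓔.Nonempty)
    (Bel : 𝓔 → Set.Icc (0 : ℝ) 1) :
    List.TFAE [Coherent1 Bel, Coherent2 Bel, Coherent3 Bel, Coherent4 Bel, Coherent5 Bel] := by
  tfae_have 2 → 1 := Coherent2.coherent1
  tfae_have 1 → 3 := Coherent1.coherent3
  tfae_have 3 → 2 := Coherent3.coherent2 h𝓔
  tfae_have 3 → 4 := Coherent3.coherent4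
  tfae_have 4 → 5 := Coherent4.coherent5
  tfae_have 5 → 3 := Coherent5.coherent3
  tfae_finish
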